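/- Let $\Theta$ be a finite set of states and $\Delta=\Delta(\Theta)$ the set of beliefs. A decision problem consists of a nonempty set of actions $A$ and a bounded utility function $u\colon A\times\Theta\to\mathbb R$. Write $\mathbb E_x u(a,\theta)=\sum_{\theta\in\Theta} x(\theta)u(a,\theta)$, and call $a\in A$ undominated if there is a belief $x\in\Delta$ with $\mathbb E_xu(a,\theta)>\mathbb E_xu(b,\theta)$ for all $b\in A\setminus\{a\}$. Only decision problems are considered in which finitely many actions are undominated and at every belief some undominated action is optimal; thus the value function $V(x)=\max_{a\in A}\mathbb E_xu(a,\theta)$ is the maximum of finitely many affine functions on $\Delta$. A Blackwell experiment $\pi$ consists of a measurable space $S$ of signal realizations and a probability distribution $\pi(\cdot\mid\theta)$ on $S$ for each $\theta\in\Theta$. Given a prior $\mu\in\Delta$, let $F=B(\mu,\pi)$ be the distribution of the posterior obtained from $\mu$ by Bayes' rule after observing the signal. The value of information of $\pi$ for the decision problem and prior $\mu$ is $$W(\pi)=\mathbb E_{F}[V(X)]-V(\mu),$$ normalized so that no information has value $0$. A collection of ranked experiments and utility differences is a finite list of statements of the forms $\pi_i\succ\pi_j$, $\pi_k\sim\pi_l$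 and "$W(\pi_i)=W(\pi_j)+\zeta_l$", where the $\pi$'s are Blackwell experiments and $\zeta_l\in\mathbb R$. A decision problem with prior $\mu$ satisfies the collection if its value of information $W$ fulfils $W(\pi_i)>W(\pi_j)$, $W(\pi_k)=W(\pi_l)$ and $W(\pi_i)=W(\pi_j)+\zeta_l$ for all statements of the respective forms. The collection identifies the value of information $W$ if 1. for every full-support prior $\mu$ there is a decision problem that, with prior $\mu$, satisfies the collection and has value of information $W(\pi)$ for every experiment $\pi$; and 2. every decision problem and full-support prior that satisfy the collection have value of information $W(\pi)$ for every experiment $\pi$. **Theorem.** For every decision problem and every full-support prior, with value of information $W$, there exists a collection of ranked experiments and utility differences that identifies $W$. -/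

import Mathlib

open MeasureTheory

universe u v w

noncomputable section

namespace ValueOfInformation

/-- The expected payoff `E_x f` of a state-dependent payoff `f` at a belief `x`. -/
def expectedPayoff {Θ : Type u} [Fintype Θ] (x f : Θ → ℝ) : ℝ := ∑ θ, x θ * f θ

/-- An action is undominated if it is the unique optimal action at some belief. -/
def Undominated {Θ : Type u} [Fintype Θ] {A : Type v} (util : A → Θ → ℝ) (a : A) : Prop :=
  ∃ x ∈ stdSimplex ℝ Θ, ∀ b : A, b ≠ a → expectedPayoff x (util b) < expectedPayoff x (util a)

/-- A decision problem with state space `Θ`: a nonempty (possibly infinite) set of actions and a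
bounded utility function, with finitely many undominated actions; at every belief the maximal
expected payoff is attained, and it is attained by an undominated action, so that the value
function is the maximum of finitely many affine functions. -/
structure DecisionProblem (Θ : Type u) [Fintype Θ] where
  Action : Type v
  nonempty_action : Nonempty Action
  utility : Action → Θ → ℝ
  bounded_utility : ∃ M : ℝ, ∀ a θ, |utility a θ| ≤ M
  finite_undominated : {a : Action | Undominated utility a}.Finite
  exists_undominated_optimal : ∀ x ∈ stdSimplex ℝ Θ, ∃ a : Action, Undominated utility a ∧
    ∀ b : Action, expectedPayoff x (utility b) ≤ expectedPayoff x (utility a)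

/-- The value function `V x = max_a E_x u(a, ·)`. The supremum is a maximum at every belief. -/
def DecisionProblem.value {Θ : Type u} [Fintype Θ] (D : DecisionProblem.{u, v} Θ)
    (x : Θ → ℝ) : ℝ :=
  ⨆ a : D.Action, expectedPayoff x (D.utility a)

/-- A prior with full support. -/
def IsFullSupportPrior {Θ : Type u} [Fintype Θ] (μ : Θ → ℝ) : Prop :=
  μ ∈ stdSimplex ℝ Θ ∧ ∀ θ, 0 < μ θ

/-- A Blackwell experiment: a measurable space of signal realizations and, for each state, a
probability distribution of the signal conditional on that state. -/
structure Experiment (Θ : Type u) where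
  Signal : Type w
  measurableSpace : MeasurableSpace Signal
  law : Θ → Measure Signal
  isProbabilityMeasure_law : ∀ θ, IsProbabilityMeasure (law θ)

attribute [instance] Experiment.measurableSpace Experiment.isProbabilityMeasure_law

/-- The unconditional distribution of the signal under the prior `μ`. -/
def Experiment.marginal {Θ : Type u} [Fintype Θ] (π : Experiment.{u, w} Θ) (μ : Θ → ℝ) :
    Measure π.Signal :=
  ∑ θ, ENNReal.ofReal (μ θ) • π.law θ

/-- Bayes' rule: the posterior probability of `θ` after the signal realization `s` is `μ θ` times
the density at `s` of the conditional law of the signal with respect to its unconditional law. -/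
def Experiment.posterior {Θ : Type u} [Fintype Θ] (π : Experiment.{u, w} Θ) (μ : Θ → ℝ)
    (s : π.Signal) : Θ → ℝ :=
  fun θ => μ θ * ((π.law θ).rnDeriv (π.marginal μ) s).toReal

/-- The Bayes map: the distribution of the random posterior. -/
def bayesMap {Θ : Type u} [Fintype Θ] (μ : Θ → ℝ) (π : Experiment.{u, w} Θ) :
    Measure (Θ → ℝ) :=
  (π.marginal μ).map (π.posterior μ)

/-- The value of information of `π`: the expected payoff from observing `π` and then acting
optimally, normalized so that observing nothing has value `0`. -/
def DecisionProblem.infoValue {Θ : Type u} [Fintype Θ] (D : DecisionProblem.{u, v} Θ)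
    (μ : Θ → ℝ) (π : Experiment.{u, w} Θ) : ℝ :=
  (∫ x, D.value x ∂(bayesMap μ π)) - D.value μ

/-- A finite collection of ranked experiments and utility differences: strict rankings
`π ≻ π'`, indifferences `π ∼ π'`, and equalities `W π = W π' + ζ`. -/
structure Collection (Θ : Type u) where
  strict : List (Experiment.{u, w} Θ × Experiment.{u, w} Θ)
  indifferent : List (Experiment.{u, w} Θ × Experiment.{u, w} Θ)
  difference : List (Experiment.{u, w} Θ × Experiment.{u, w} Θ × ℝ)

/-- The decision problem `D` with prior `μ` satisfies every statement of the collection. -/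
def Collection.SatisfiedBy {Θ : Type u} [Fintype Θ] (C : Collection.{u, w} Θ)
    (D : DecisionProblem.{u, v} Θ) (μ : Θ → ℝ) : Prop :=
  (∀ p ∈ C.strict, D.infoValue μ p.2 < D.infoValue μ p.1) ∧
  (∀ p ∈ C.indifferent, D.infoValue μ p.1 = D.infoValue μ p.2) ∧
  (∀ p ∈ C.difference, D.infoValue μ p.1 = D.infoValue μ p.2.1 + p.2.2)

/-- The collection identifies the value of information `W`: for every full-support prior some
decision problem satisfies the collection and has value of information `W`, and every decision
problem and full-support prior satisfying the collection have value of information `W`. -/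
def Collection.Identifies {Θ : Type u} [Fintype Θ] (C : Collection.{u, w} Θ)
    (W : Experiment.{u, w} Θ → ℝ) : Prop :=
  (∀ μ : Θ → ℝ, IsFullSupportPrior μ →
    ∃ D : DecisionProblem.{u, v} Θ, C.SatisfiedBy D μ ∧ ∀ π, D.infoValue μ π = W π) ∧
  (∀ (D : DecisionProblem.{u, v} Θ) (μ : Θ → ℝ), IsFullSupportPrior μ →
    C.SatisfiedBy D μ → ∀ π, D.infoValue μ π = W π)

end ValueOfInformation

end

noncomputable section

namespace ValueOfInformation

open Filter Topology

variable {Θ : Type u} [Fintype Θ]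

/-! Put `U z = D.value (μ * z)` on the nonnegative orthant. By positive homogeneity, the value of an
experiment is the integral of `U` over the vector of signal densities, minus `U 1`
(`integral_value_bayesMap`). So only `U` matters, and only modulo linear functions
(`infoValue_eq_of_value_eq_add`). A change of prior is absorbed by rescaling utilities state by
state (`exists_decisionProblem_value_eq`), which gives realizability at every full-support prior.

For uniqueness, three kinds of utility differences pin down `U` modulo linear functions. Each
undominated action of `D₀` is optimal on a small full-dimensional cone; that pooling the points of
this cone costs nothing forces a single action of `D` to be optimal at all of them
(`value_sum_eq_iff`). Differences across cones fix the relative slopes of these actions, so that, up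
to a linear function, `U` lies above `U₀`, the maximum of the corresponding finitely many pieces.
Finally, a countable family with dense rays has the same total value under both functions, so the
inequality is an equality on each ray and, by continuity, everywhere
(`exists_value_eq_add_expectedPayoff`). Families with equal totals become comparisons of experiments
through `exists_experiment_pair`. -/

lemma expectedPayoff_add (x y f : Θ → ℝ) :
    expectedPayoff (x + y) f = expectedPayoff x f + expectedPayoff y f :=
  add_dotProduct x y f

lemma expectedPayoff_smul (c : ℝ) (x f : Θ → ℝ) :
    expectedPayoff (c • x) f = c * expectedPayoff x f :=
  smul_dotProduct c x f

lemma expectedPayoff_mul (μ x f : Θ → ℝ) :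
    expectedPayoff (μ * x) f = expectedPayoff x (μ * f) :=
  Finset.sum_congr rfl fun θ _ => by simp only [Pi.mul_apply]; ring

lemma expectedPayoff_zero (f : Θ → ℝ) : expectedPayoff 0 f = 0 :=
  zero_dotProduct f

lemma expectedPayoff_finset_sum {ι : Type*} (s : Finset ι) (x : ι → Θ → ℝ) (f : Θ → ℝ) :
    expectedPayoff (∑ i ∈ s, x i) f = ∑ i ∈ s, expectedPayoff (x i) f :=
  sum_dotProduct s x f

lemma continuous_expectedPayoff (f : Θ → ℝ) : Continuous fun x => expectedPayoff x f := by
  unfold expectedPayoff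
  fun_prop

lemma abs_expectedPayoff_le {M : ℝ} {f : Θ → ℝ} (hf : ∀ θ, |f θ| ≤ M) (x : Θ → ℝ) :
    |expectedPayoff x f| ≤ Fintype.card Θ * M * ‖x‖ := by
  refine (Finset.abs_sum_le_sum_abs _ _).trans ?_
  have h : ∀ θ ∈ Finset.univ, |x θ * f θ| ≤ ‖x‖ * M := fun θ _ => by
    rw [abs_mul]
    exact mul_le_mul (norm_le_pi_norm x θ) (hf θ) (abs_nonneg _) (norm_nonneg _)
  refine (Finset.sum_le_card_nsmul _ _ _ h).trans (le_of_eq ?_)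
  rw [nsmul_eq_mul, Finset.card_univ]
  ring

/-! ### The value function off the simplex: homogeneity and Lipschitz continuity. -/

namespace DecisionProblem

variable (D : DecisionProblem.{u, v} Θ)

lemma bddAbove_range_expectedPayoff (x : Θ → ℝ) :
    BddAbove (Set.range fun a => expectedPayoff x (D.utility a)) := by
  obtain ⟨M, hM⟩ := D.bounded_utility
  refine ⟨Fintype.card Θ * M * ‖x‖, ?_⟩
  rintro _ ⟨a, rfl⟩
  exact (le_abs_self _).trans (abs_expectedPayoff_le (hM a) x)

lemma expectedPayoff_le_value (x : Θ → ℝ) (a : D.Action) :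
    expectedPayoff x (D.utility a) ≤ D.value x :=
  le_ciSup (D.bddAbove_range_expectedPayoff x) a

lemma value_smul {c : ℝ} (hc : 0 ≤ c) (x : Θ → ℝ) : D.value (c • x) = c * D.value x := by
  simp only [value, expectedPayoff_smul, Real.mul_iSup_of_nonneg hc]

lemma value_zero : D.value 0 = 0 := by
  simpa using D.value_smul le_rfl 0

lemma exists_lipschitzWith_value : ∃ K, LipschitzWith K D.value := by
  obtain ⟨M, hM⟩ := D.bounded_utility
  refine ⟨_, LipschitzWith.of_le_add_mul' (Fintype.card Θ * M) fun x y => ?_⟩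
  have := D.nonempty_action
  refine ciSup_le fun a => ?_
  have h := (le_abs_self _).trans (abs_expectedPayoff_le (hM a) (x - y))
  have h' : expectedPayoff x (D.utility a) =
      expectedPayoff y (D.utility a) + expectedPayoff (x - y) (D.utility a) := by
    rw [← expectedPayoff_add, add_sub_cancel]
  rw [h', dist_eq_norm]
  exact add_le_add (D.expectedPayoff_le_value y a) h

lemma continuous_value : Continuous D.value :=
  let ⟨_, hK⟩ := D.exists_lipschitzWith_value
  hK.continuous

lemma exists_abs_value_le : ∃ K : ℝ, ∀ x, |D.value x| ≤ K * ‖x‖ := by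
  obtain ⟨K, hK⟩ := D.exists_lipschitzWith_value
  refine ⟨K, fun x => ?_⟩
  simpa [Real.dist_eq, D.value_zero] using hK.dist_le_mul x 0

/-- Homogeneity carries optimality of undominated actions from the simplex to the whole orthant. At
the origin every action is optimal, and a vertex of the simplex supplies an undominated one. -/
lemma exists_undominated_value_eq [Nonempty Θ] {x : Θ → ℝ} (hx : 0 ≤ x) :
    ∃ a, Undominated D.utility a ∧ D.value x = expectedPayoff x (D.utility a) := by
  classical
  have key : ∀ y ∈ stdSimplex ℝ Θ, ∃ a, Undominated D.utility a ∧
      D.value y = expectedPayoff y (D.utility a) := fun y hy => by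
    obtain ⟨a, ha, hmax⟩ := D.exists_undominated_optimal y hy
    have := D.nonempty_action
    exact ⟨a, ha, le_antisymm (ciSup_le hmax) (D.expectedPayoff_le_value y a)⟩
  obtain hs | hs := (Finset.sum_nonneg fun θ (_ : θ ∈ Finset.univ) => hx θ).eq_or_lt
  · have hx0 : x = 0 := funext fun θ =>
      (Finset.sum_eq_zero_iff_of_nonneg fun θ _ => hx θ).1 hs.symm θ (Finset.mem_univ θ)
    obtain ⟨θ⟩ := ‹Nonempty Θ›
    obtain ⟨a, ha, -⟩ := key _ (single_mem_stdSimplex ℝ θ)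
    exact ⟨a, ha, by rw [hx0, D.value_zero, expectedPayoff_zero]⟩
  · set s := ∑ θ, x θ with hs_def
    obtain ⟨a, ha, h⟩ := key (s⁻¹ • x)
      ⟨fun θ => mul_nonneg (inv_nonneg.2 hs.le) (hx θ), by
        simp only [Pi.smul_apply, smul_eq_mul, ← Finset.mul_sum, ← hs_def]
        exact inv_mul_cancel₀ hs.ne'⟩
    refine ⟨a, ha, ?_⟩
    rw [D.value_smul (inv_nonneg.2 hs.le), expectedPayoff_smul] at h
    exact mul_left_cancel₀ (inv_ne_zero hs.ne') h

end DecisionProblem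

/-! ### The value of information in terms of signal densities. -/

lemma IsFullSupportPrior.nonempty {μ : Θ → ℝ} (hμ : IsFullSupportPrior μ) : Nonempty Θ := by
  by_contra h
  rw [not_nonempty_iff] at h
  simpa using hμ.1.2

/-- The value of information as an integral over densities with respect to an arbitrary
dominating measure. -/
lemma integral_value_bayesMap (D : DecisionProblem.{u, v} Θ) {μ : Θ → ℝ}
    (hμ : IsFullSupportPrior μ) (π : Experiment.{u, w} Θ) (ν : Measure π.Signal) [SigmaFinite ν]
    (hν : ∀ θ, π.law θ ≪ ν) :
    ∫ x, D.value x ∂(bayesMap μ π) =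
      ∫ s, D.value (μ * fun θ => ((π.law θ).rnDeriv ν s).toReal) ∂ν := by
  have : IsFiniteMeasure (π.marginal μ) := by
    refine ⟨?_⟩
    simp only [Experiment.marginal, Measure.coe_finsetSum, Finset.sum_apply, Measure.smul_apply,
      measure_univ, smul_eq_mul, mul_one]
    exact ENNReal.sum_lt_top.2 fun θ _ => ENNReal.ofReal_lt_top
  have hmν : π.marginal μ ≪ ν := by
    intro t ht
    simp [Experiment.marginal, fun θ => hν θ ht]
  have hm : ∀ θ, π.law θ ≪ π.marginal μ := by
    intro θ t ht
    simp only [Experiment.marginal, Measure.coe_finsetSum, Finset.sum_apply, Measure.smul_apply,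
      smul_eq_mul, Finset.sum_eq_zero_iff, Finset.mem_univ, true_implies, mul_eq_zero] at ht
    exact (ht θ).resolve_left (ENNReal.ofReal_pos.2 (hμ.2 θ)).ne'
  have hmeas : Measurable (π.posterior μ) :=
    measurable_pi_lambda _ fun θ =>
      ((Measure.measurable_rnDeriv _ _).ennreal_toReal).const_mul _
  rw [bayesMap, integral_map hmeas.aemeasurable D.continuous_value.aestronglyMeasurable,
    ← integral_rnDeriv_smul hmν]
  refine integral_congr_ae ?_
  -- Chain rule for densities; homogeneity then moves the density of the marginal inside the value
  -- function.
  have hall : ∀ᵐ s ∂ν, ∀ θ, (π.law θ).rnDeriv (π.marginal μ) s * (π.marginal μ).rnDeriv ν s =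
      (π.law θ).rnDeriv ν s := ae_all_iff.2 fun θ => Measure.rnDeriv_mul_rnDeriv (hm θ)
  filter_upwards [hall] with s hs
  rw [smul_eq_mul, ← D.value_smul ENNReal.toReal_nonneg]
  congr 1
  funext θ
  simp only [Pi.smul_apply, Pi.mul_apply, Experiment.posterior, smul_eq_mul, ← hs θ,
    ENNReal.toReal_mul]
  ring

lemma exists_isFiniteMeasure_dominating (π : Experiment.{u, w} Θ) :
    ∃ ν : Measure π.Signal, IsFiniteMeasure ν ∧ ∀ θ, π.law θ ≪ ν := by
  refine ⟨∑ θ, π.law θ, ⟨?_⟩, fun θ t ht => ?_⟩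
  · simp
  · simp only [Measure.coe_finsetSum, Finset.sum_apply, Finset.sum_eq_zero_iff, Finset.mem_univ,
      true_implies] at ht
    exact ht θ

/-- Decision problems whose prior-weighted value functions differ by a linear function have the
same value of information. -/
lemma infoValue_eq_of_value_eq_add (D D' : DecisionProblem.{u, v} Θ) {μ μ' : Θ → ℝ}
    (hμ : IsFullSupportPrior μ) (hμ' : IsFullSupportPrior μ') (ℓ : Θ → ℝ)
    (h : ∀ z, 0 ≤ z → D.value (μ * z) = D'.value (μ' * z) + expectedPayoff z ℓ)
    (π : Experiment.{u, w} Θ) : D.infoValue μ π = D'.infoValue μ' π := by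
  obtain ⟨ν, hfin, hν⟩ := exists_isFiniteMeasure_dominating π
  rw [DecisionProblem.infoValue, DecisionProblem.infoValue,
    integral_value_bayesMap D hμ π ν hν, integral_value_bayesMap D' hμ' π ν hν]
  set f : π.Signal → Θ → ℝ := fun s θ => ((π.law θ).rnDeriv ν s).toReal with hf
  have hf0 : ∀ s, 0 ≤ f s := fun s θ => ENNReal.toReal_nonneg
  have hfθ : ∀ θ, Integrable (fun s => f s θ) ν := fun θ => Measure.integrable_toReal_rnDeriv
  have hf_int : Integrable f ν := Integrable.of_eval hfθ
  obtain ⟨K, hK⟩ := D'.exists_abs_value_le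
  have hcont : Continuous fun z : Θ → ℝ => D'.value (μ' * z) :=
    D'.continuous_value.comp (continuous_const.mul continuous_id)
  have hint : Integrable (fun s => D'.value (μ' * f s)) ν := by
    refine Integrable.mono' ((hf_int.norm.const_mul ‖μ'‖).const_mul |K|)
      (hcont.comp_aestronglyMeasurable hf_int.aestronglyMeasurable) (ae_of_all _ fun s => ?_)
    refine (hK _).trans ?_
    exact mul_le_mul (le_abs_self K) (norm_mul_le _ _) (norm_nonneg _) (abs_nonneg K)
  have hlin : Integrable (fun s => expectedPayoff (f s) ℓ) ν :=
    integrable_finsetSum _ fun θ _ => (hfθ θ).mul_const _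
  -- Each density integrates to `1`, so the linear term contributes the same constant to every
  -- experiment, and the normalization at `z = 1` cancels it.
  have hval : ∫ s, expectedPayoff (f s) ℓ ∂ν = expectedPayoff 1 ℓ := by
    unfold expectedPayoff
    rw [integral_finsetSum _ fun θ _ => (hfθ θ).mul_const _]
    refine Finset.sum_congr rfl fun θ _ => ?_
    rw [integral_mul_const, Measure.integral_toReal_rnDeriv (hν θ)]
    simp
  have h1 := h 1 zero_le_one
  rw [mul_one, mul_one] at h1
  have h2 : ∫ s, D.value (μ * f s) ∂ν = ∫ s, D'.value (μ' * f s) + expectedPayoff (f s) ℓ ∂ν :=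
    integral_congr_ae (ae_of_all _ fun s => h _ (hf0 s))
  rw [h2, integral_add hint hlin, hval, h1]
  ring

/-! ### Experiments with countably many signals. -/

/-- A countable nonnegative family of state-dependent signal probabilities summing to `1` is
realized by an experiment. -/
lemma exists_experiment_infoValue_eq_tsum {ι : Type*} [Countable ι] (q : ι → Θ → ℝ)
    (hq : ∀ i, 0 ≤ q i) (hsum : HasSum q 1) :
    ∃ π : Experiment.{u, w} Θ, ∀ (D : DecisionProblem.{u, v} Θ) (μ : Θ → ℝ),
      IsFullSupportPrior μ → D.infoValue μ π = ∑' i, D.value (μ * q i) - D.value μ := by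
  -- A countable type has a copy in every universe, so the signal space can live in `Type w`.
  obtain ⟨S, ⟨e⟩⟩ : ∃ S : Type w, Nonempty (ι ≃ S) := Small.equiv_small
  let _ : MeasurableSpace S := ⊤
  have : Countable S := e.symm.injective.countable
  let f : Θ → S → ENNReal := fun θ s => ENNReal.ofReal (q (e.symm s) θ)
  have hf : ∀ θ, Measurable (f θ) := fun θ => measurable_from_top
  have hprob : ∀ θ, IsProbabilityMeasure (Measure.count.withDensity (f θ)) := fun θ => by
    have hθ : HasSum (fun i => q i θ) 1 := Pi.hasSum.1 hsum θ
    refine ⟨?_⟩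
    rw [withDensity_apply _ MeasurableSet.univ, Measure.restrict_univ, lintegral_count,
      e.symm.tsum_eq (fun i => ENNReal.ofReal (q i θ)),
      ← ENNReal.ofReal_tsum_of_nonneg (fun i => hq i θ) hθ.summable, hθ.tsum_eq,
      ENNReal.ofReal_one]
  refine ⟨⟨S, ⊤, fun θ => Measure.count.withDensity (f θ), hprob⟩,
    fun D μ hμ => ?_⟩
  rw [DecisionProblem.infoValue, integral_value_bayesMap D hμ _ Measure.count
    fun θ => withDensity_absolutelyContinuous _ _]
  congr 1
  have hall : ∀ᵐ s ∂(Measure.count : Measure S), ∀ θ,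
      (Measure.count.withDensity (f θ)).rnDeriv Measure.count s = f θ s :=
    ae_all_iff.2 fun θ => Measure.rnDeriv_withDensity _ (hf θ)
  have hcongr : ∫ s, D.value (μ * fun θ =>
      ((Measure.count.withDensity (f θ)).rnDeriv Measure.count s).toReal) ∂Measure.count =
      ∫ s, D.value (μ * q (e.symm s)) ∂(Measure.count : Measure S) := by
    refine integral_congr_ae ?_
    filter_upwards [hall] with s hs
    simp only [hs]
    congr 2
    funext θ
    exact ENNReal.toReal_ofReal (hq _ θ)
  refine hcongr.trans ?_
  obtain ⟨K, hK⟩ := D.exists_abs_value_le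
  have hsummable : Summable fun i => ‖D.value (μ * q i)‖ := by
    refine Summable.of_nonneg_of_le (fun _ => norm_nonneg _) (fun i => ?_)
      (((summable_norm_iff.2 hsum.summable).mul_left ‖μ‖).mul_left |K|)
    exact (hK _).trans
      (mul_le_mul (le_abs_self K) (norm_mul_le _ _) (norm_nonneg _) (abs_nonneg K))
  have hint : Integrable (fun s => D.value (μ * q (e.symm s)))
      (Measure.count : Measure S) :=
    integrable_count_iff.2 (e.symm.summable_iff.2 hsummable)
  rw [integral_countable hint]
  simp only [Measure.real, Measure.count_singleton, ENNReal.toReal_one, one_smul]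
  exact e.symm.tsum_eq fun i => D.value (μ * q i)

lemma hasSum_sumElim_sub {ι E : Type*} [AddCommGroup E] [TopologicalSpace E] [ContinuousAdd E]
    {q : ι → E} {x : E} (hq : HasSum q x) (y : E) : HasSum (Sum.elim q fun _ : Unit => y - x) y := by
  have h2 : HasSum (fun _ : Unit => y - x) (y - x) := by
    simp [hasSum_unique]
  simpa using HasSum.sum (f := Sum.elim q fun _ : Unit => y - x) hq h2

lemma exists_pos_smul_le_one (y : Θ → ℝ) : ∃ c : ℝ, 0 < c ∧ c • y ≤ 1 := by
  have hpos : 0 < 1 + ‖y‖ := by positivity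
  refine ⟨(1 + ‖y‖)⁻¹, inv_pos.2 hpos, fun θ => ?_⟩
  rw [Pi.smul_apply, smul_eq_mul, Pi.one_apply, inv_mul_le_one₀ hpos]
  have := (le_abs_self _).trans (norm_le_pi_norm y θ)
  linarith

namespace DecisionProblem

lemma summable_value (D : DecisionProblem.{u, v} Θ) (μ : Θ → ℝ) {ι : Type*} {q : ι → Θ → ℝ}
    (hq : Summable q) : Summable fun i => D.value (μ * q i) := by
  obtain ⟨K, hK⟩ := D.exists_abs_value_le
  refine Summable.of_norm_bounded (((summable_norm_iff.2 hq).mul_left ‖μ‖).mul_left |K|)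
    fun i => (hK _).trans ?_
  exact mul_le_mul (le_abs_self K) (norm_mul_le _ _) (norm_nonneg _) (abs_nonneg K)

lemma value_mul_smul (D : DecisionProblem.{u, v} Θ) (μ : Θ → ℝ) {c : ℝ} (hc : 0 ≤ c)
    (z : Θ → ℝ) : D.value (μ * c • z) = c * D.value (μ * z) := by
  rw [mul_smul_comm, D.value_smul hc]

end DecisionProblem

/-- After scaling by `c` the family fits below `1`, and one extra signal carries the remainder `1 -
c • y`. Its contribution depends on the family only through the total `y`, so it cancels between
families with equal totals. -/
lemma exists_experiment_scaled {ι : Type*} [Countable ι] {q : ι → Θ → ℝ} (hq : ∀ i, 0 ≤ q i)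
    {y : Θ → ℝ} (hqy : HasSum q y) {c : ℝ} (hc : 0 ≤ c) (hcy : c • y ≤ 1) :
    ∃ π : Experiment.{u, w} Θ, ∀ (D : DecisionProblem.{u, v} Θ) (μ : Θ → ℝ),
      IsFullSupportPrior μ → D.infoValue μ π =
        c * ∑' i, D.value (μ * q i) + D.value (μ * (1 - c • y)) - D.value μ := by
  have hsum := hasSum_sumElim_sub (hqy.const_smul c) 1
  obtain ⟨π, hπ⟩ := exists_experiment_infoValue_eq_tsum.{u, v, w} _
    (by rintro (i | i)
        · exact smul_nonneg hc (hq i)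
        · exact sub_nonneg.2 hcy) hsum
  refine ⟨π, fun D μ hμ => ?_⟩
  rw [hπ D μ hμ, Summable.tsum_sum]
  · simp only [Sum.elim_inl, Sum.elim_inr, D.value_mul_smul μ hc, tsum_mul_left,
      tsum_fintype, Finset.univ_unique, Finset.sum_singleton]
  · exact D.summable_value μ (hqy.const_smul c).summable
  · exact (hasSum_fintype _).summable

/-- Two families with the same total give a pair of experiments whose difference in value is
proportional to the difference of the sums of values over the families. -/
lemma exists_experiment_pair {ι κ : Type*} [Countable ι] [Countable κ] {q : ι → Θ → ℝ}
    {r : κ → Θ → ℝ} (hq : ∀ i, 0 ≤ q i) (hr : ∀ i, 0 ≤ r i) {y : Θ → ℝ} (hqy : HasSum q y)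
    (hry : HasSum r y) :
    ∃ (π π' : Experiment.{u, w} Θ) (c : ℝ), 0 < c ∧
      ∀ (D : DecisionProblem.{u, v} Θ) (μ : Θ → ℝ), IsFullSupportPrior μ →
        D.infoValue μ π - D.infoValue μ π' =
          c * (∑' i, D.value (μ * q i) - ∑' i, D.value (μ * r i)) := by
  obtain ⟨c, hc, hcy⟩ := exists_pos_smul_le_one y
  obtain ⟨π, hπ⟩ := exists_experiment_scaled.{u, v, w} hq hqy hc.le hcy
  obtain ⟨π', hπ'⟩ := exists_experiment_scaled.{u, v, w} hr hry hc.le hcy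
  refine ⟨π, π', c, hc, fun D μ hμ => ?_⟩
  rw [hπ D μ hμ, hπ' D μ hμ]
  ring

/-- A finite list of statements about utility differences. -/
lemma exists_collection {J : Type*} [Finite J] (π π' : J → Experiment.{u, w} Θ) (ζ : J → ℝ) :
    ∃ C : Collection.{u, w} Θ, ∀ (D : DecisionProblem.{u, v} Θ) (μ : Θ → ℝ),
      C.SatisfiedBy D μ ↔ ∀ j, D.infoValue μ (π j) - D.infoValue μ (π' j) = ζ j := by
  have := Fintype.ofFinite J
  refine ⟨⟨[], [], Finset.univ.toList.map fun j => (π j, π' j, ζ j)⟩, fun D μ => ?_⟩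
  simp [Collection.SatisfiedBy, sub_eq_iff_eq_add']

/-! ### Undominated actions and change of prior. -/

lemma undominated_of_nonneg {A : Type v} {util : A → Θ → ℝ} {a : A} {x : Θ → ℝ} (hx : 0 ≤ x)
    (hx0 : x ≠ 0)
    (h : ∀ b, b ≠ a → expectedPayoff x (util b) < expectedPayoff x (util a)) :
    Undominated util a := by
  have hs : 0 < ∑ θ, x θ := by
    obtain ⟨θ, hθ⟩ := Function.ne_iff.1 hx0
    exact Finset.sum_pos' (fun θ _ => hx θ)
      ⟨θ, Finset.mem_univ θ, lt_of_le_of_ne (hx θ) (Ne.symm hθ)⟩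
  refine ⟨(∑ θ, x θ)⁻¹ • x, ⟨fun θ => mul_nonneg (inv_nonneg.2 hs.le) (hx θ), ?_⟩,
    fun b hb => ?_⟩
  · simp only [Pi.smul_apply, smul_eq_mul, ← Finset.mul_sum]
    exact inv_mul_cancel₀ hs.ne'
  · rw [expectedPayoff_smul, expectedPayoff_smul]
    exact mul_lt_mul_of_pos_left (h b hb) (inv_pos.2 hs)

lemma Undominated.mul_left {A : Type v} {util : A → Θ → ℝ} {a : A} (h : Undominated util a)
    {r : Θ → ℝ} (hr : ∀ θ, 0 < r θ) : Undominated (fun b => r * util b) a := by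
  obtain ⟨x, hx, hlt⟩ := h
  have hrx : ∀ b, expectedPayoff (r⁻¹ * x) (r * util b) = expectedPayoff x (util b) := fun b => by
    rw [← expectedPayoff_mul]
    congr 1
    funext θ
    exact mul_inv_cancel_left₀ (hr θ).ne' (x θ)
  refine undominated_of_nonneg (x := r⁻¹ * x)
    (fun θ => mul_nonneg (inv_nonneg.2 (hr θ).le) (hx.1 θ)) (fun h0 => ?_) fun b hb => ?_
  · have hx0 : ∀ θ, x θ = 0 := fun θ =>
      (mul_eq_zero.1 (congrFun h0 θ)).resolve_left (inv_ne_zero (hr θ).ne')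
    simpa [hx0] using hx.2
  · rw [hrx, hrx]
    exact hlt b hb

/-- Rescaling payoffs state by state compensates for a change of the prior. -/
lemma exists_decisionProblem_value_eq (D₀ : DecisionProblem.{u, v} Θ) {μ₀ μ : Θ → ℝ}
    (hμ₀ : IsFullSupportPrior μ₀) (hμ : IsFullSupportPrior μ) :
    ∃ D : DecisionProblem.{u, v} Θ, ∀ z, D.value (μ * z) = D₀.value (μ₀ * z) := by
  have := hμ.nonempty
  set r : Θ → ℝ := μ₀ / μ with hr_def
  have hr : ∀ θ, 0 < r θ := fun θ => div_pos (hμ₀.2 θ) (hμ.2 θ)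
  have hinv : ∀ a, Undominated (fun b => r * D₀.utility b) a → Undominated D₀.utility a :=
    fun a ha => by
      have h := ha.mul_left (r := r⁻¹) fun θ => inv_pos.2 (hr θ)
      convert h using 2 with b
      funext θ
      exact (inv_mul_cancel_left₀ (hr θ).ne' _).symm
  obtain ⟨M, hM⟩ := D₀.bounded_utility
  refine ⟨⟨D₀.Action, D₀.nonempty_action, fun a => r * D₀.utility a, ⟨‖r‖ * M, fun a θ => ?_⟩,
    D₀.finite_undominated.subset hinv, fun x hx => ?_⟩, fun z => ?_⟩
  · rw [Pi.mul_apply, abs_mul]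
    exact mul_le_mul (norm_le_pi_norm r θ) (hM a θ) (abs_nonneg _) (norm_nonneg _)
  · obtain ⟨a, ha, hval⟩ := D₀.exists_undominated_value_eq (x := r * x)
      fun θ => mul_nonneg (hr θ).le (hx.1 θ)
    refine ⟨a, ha.mul_left hr, fun b => ?_⟩
    rw [← expectedPayoff_mul, ← expectedPayoff_mul, ← hval]
    exact D₀.expectedPayoff_le_value _ b
  · refine iSup_congr fun a => ?_
    change expectedPayoff (μ * z) (r * D₀.utility a) = _
    rw [← expectedPayoff_mul, ← mul_assoc]
    congr 2
    funext θ
    exact div_mul_cancel₀ _ (hμ.2 θ).ne'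

/-! ### Cones on which one action is optimal. -/

namespace DecisionProblem

/-- The value is additive on a finite family of beliefs (up to scale) exactly when a single
action is optimal at all of them. -/
lemma value_sum_eq_iff [Nonempty Θ] (D : DecisionProblem.{u, v} Θ) {ι : Type*} [Fintype ι]
    {x : ι → Θ → ℝ} (hx : ∀ i, 0 ≤ x i) :
    D.value (∑ i, x i) = ∑ i, D.value (x i) ↔
      ∃ a, ∀ i, D.value (x i) = expectedPayoff (x i) (D.utility a) := by
  -- An action optimal at the sum attains the termwise bound in total only if it is optimal at every
  -- summand.
  obtain ⟨a, -, ha⟩ := D.exists_undominated_value_eq (Finset.sum_nonneg fun i _ => hx i)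
  rw [expectedPayoff_finset_sum] at ha
  constructor
  · intro h
    refine ⟨a, fun i => ?_⟩
    exact ((Finset.sum_eq_sum_iff_of_le fun i _ => D.expectedPayoff_le_value (x i) a).1
      (ha.symm.trans h) i (Finset.mem_univ i)).symm
  · rintro ⟨b, hb⟩
    refine le_antisymm ?_ ?_
    · rw [ha]
      exact Finset.sum_le_sum fun i _ => D.expectedPayoff_le_value (x i) a
    · simp only [hb, ← expectedPayoff_finset_sum]
      exact D.expectedPayoff_le_value _ b

/-- Every undominated action is optimal on a small simplicial cone, with a common size. -/
lemma exists_cone_of_undominated [DecidableEq Θ] (D : DecisionProblem.{u, v} Θ) {μ : Θ → ℝ}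
    (hμ : IsFullSupportPrior μ) :
    ∃ (z : D.Action → Θ → ℝ) (ε : ℝ), 0 < ε ∧ ∀ a, Undominated D.utility a → 0 ≤ z a ∧
      D.value (μ * z a) = expectedPayoff (μ * z a) (D.utility a) ∧
      ∀ θ, D.value (μ * (z a + ε • Pi.single θ 1)) =
        expectedPayoff (μ * (z a + ε • Pi.single θ 1)) (D.utility a) := by
  have := hμ.nonempty
  have hpt : ∀ a, ∃ z : Θ → ℝ, Undominated D.utility a → 0 ≤ z ∧ ∀ b, b ≠ a →
      expectedPayoff (μ * z) (D.utility b) < expectedPayoff (μ * z) (D.utility a) := by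
    intro a
    by_cases ha : Undominated D.utility a
    · obtain ⟨x, hx, hlt⟩ := ha
      have hxz : μ * (x / μ) = x := funext fun θ => mul_div_cancel₀ _ (hμ.2 θ).ne'
      exact ⟨x / μ, fun _ => ⟨fun θ => div_nonneg (hx.1 θ) (hμ.2 θ).le, by rwa [hxz]⟩⟩
    · exact ⟨0, fun h => absurd h ha⟩
  choose z hz using hpt
  -- Strict inequalities survive small displacements. Comparing undominated actions only leaves
  -- finitely many of them, so one `ε` serves all.
  have hev : ∀ᶠ ε in 𝓝[>] (0 : ℝ), ∀ a ∈ {a | Undominated D.utility a},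
      ∀ b ∈ {a | Undominated D.utility a}, b ≠ a → ∀ θ,
        expectedPayoff (μ * (z a + ε • Pi.single θ 1)) (D.utility b) <
          expectedPayoff (μ * (z a + ε • Pi.single θ 1)) (D.utility a) := by
    refine (eventually_all_finite D.finite_undominated).2 fun a ha =>
      (eventually_all_finite D.finite_undominated).2 fun b _ => ?_
    by_cases hba : b = a
    · exact Eventually.of_forall fun _ h => absurd hba h
    · simp only [ne_eq, hba, not_false_eq_true, true_implies]
      refine nhdsWithin_le_nhds (eventually_all.2 fun θ => ?_)
      have hcont : ∀ f : Θ → ℝ, Continuous fun ε : ℝ =>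
          expectedPayoff (μ * (z a + ε • Pi.single θ 1)) f := fun f =>
        (continuous_expectedPayoff f).comp (by fun_prop)
      refine ((hcont _).tendsto 0).eventually_lt ((hcont _).tendsto 0) ?_
      simpa using (hz a ha).2 b hba
  obtain ⟨ε, hε, hε0⟩ := (hev.and self_mem_nhdsWithin).exists
  have hopt : ∀ (a : D.Action) (x : Θ → ℝ), 0 ≤ x →
      (∀ b, Undominated D.utility b → b ≠ a →
        expectedPayoff x (D.utility b) < expectedPayoff x (D.utility a)) →
      D.value x = expectedPayoff x (D.utility a) := by
    intro a x hx h
    obtain ⟨b, hb, hval⟩ := D.exists_undominated_value_eq hx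
    by_cases hba : b = a
    · rw [hval, hba]
    · exact absurd (D.expectedPayoff_le_value x a) (not_le.2 (hval ▸ h b hb hba))
  have hμ0 : 0 ≤ μ := hμ.1.1
  refine ⟨z, ε, hε0, fun a ha => ⟨(hz a ha).1, ?_, fun θ => ?_⟩⟩
  · exact hopt a _ (mul_nonneg hμ0 (hz a ha).1) fun b _ hba => (hz a ha).2 b hba
  · refine hopt a _ (mul_nonneg hμ0 (add_nonneg (hz a ha).1 ?_)) fun b hb hba =>
      hε a ha b hb hba θ
    exact smul_nonneg (le_of_lt hε0) (Pi.single_nonneg.2 zero_le_one)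

end DecisionProblem

/-! ### A summable family with dense rays. -/

/-- A strictly positive vector is the sum of a countable nonnegative family whose rays are dense
in the orthant. -/
lemma exists_hasSum_dense_rays {y : Θ → ℝ} (hy : ∀ θ, 0 < y θ) :
    ∃ q : ℕ ⊕ Unit → Θ → ℝ, (∀ i, 0 ≤ q i) ∧ HasSum q y ∧
      {z : Θ → ℝ | 0 ≤ z} ⊆ closure {z | ∃ c : ℝ, ∃ i, 0 < c ∧ z = c • q i} := by
  obtain ⟨δ, hδ, hδy⟩ := exists_pos_smul_le_one y⁻¹
  have hδy' : ∀ θ, δ ≤ y θ := fun θ => by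
    have h := hδy θ
    simp only [Pi.smul_apply, Pi.inv_apply, smul_eq_mul, Pi.one_apply] at h
    rwa [← div_eq_mul_inv, div_le_one (hy θ)] at h
  have : Nonempty {z : Θ → ℝ // 0 ≤ z} := ⟨⟨0, le_rfl⟩⟩
  let d := TopologicalSpace.denseSeq {z : Θ → ℝ // 0 ≤ z}
  -- Normalizing `d k` brings its entries below `1`, and the geometric weights sum to `δ`, a lower
  -- bound for the coordinates of `y`. Hence the remainder after summation is nonnegative and can
  -- join the family.
  let c : ℕ → ℝ := fun k => δ / 2 / 2 ^ k * (1 + ‖(d k : Θ → ℝ)‖)⁻¹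
  have hc : ∀ k, 0 < c k := fun k => by positivity
  have hq0 : ∀ k, 0 ≤ c k • (d k : Θ → ℝ) := fun k => smul_nonneg (hc k).le (d k).2
  have hbound : ∀ θ k, (c k • (d k : Θ → ℝ)) θ ≤ δ / 2 / 2 ^ k := fun θ k => by
    have h1 := (le_abs_self _).trans (norm_le_pi_norm (d k : Θ → ℝ) θ)
    have h2 : (1 + ‖(d k : Θ → ℝ)‖)⁻¹ * (d k : Θ → ℝ) θ ≤ 1 := by
      rw [inv_mul_le_one₀ (by positivity)]
      linarith
    calc (c k • (d k : Θ → ℝ)) θ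
        = δ / 2 / 2 ^ k * ((1 + ‖(d k : Θ → ℝ)‖)⁻¹ * (d k : Θ → ℝ) θ) := mul_assoc _ _ _
      _ ≤ δ / 2 / 2 ^ k * 1 := mul_le_mul_of_nonneg_left h2 (by positivity)
      _ = δ / 2 / 2 ^ k := mul_one _
  have hgeom : HasSum (fun k : ℕ => δ / 2 / 2 ^ k) δ := hasSum_geometric_two' δ
  have hsummable : Summable fun k => c k • (d k : Θ → ℝ) := Pi.summable.2 fun θ =>
    Summable.of_nonneg_of_le (fun k => hq0 k θ) (hbound θ) hgeom.summable
  have hle : ∑' k, c k • (d k : Θ → ℝ) ≤ y := fun θ => by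
    rw [tsum_apply hsummable]
    exact ((Pi.summable.1 hsummable θ).tsum_le_tsum (hbound θ) hgeom.summable).trans
      (hgeom.tsum_eq.le.trans (hδy' θ))
  refine ⟨_, ?_, hasSum_sumElim_sub hsummable.hasSum y, fun z hz => ?_⟩
  · rintro (k | k)
    · exact hq0 k
    · exact sub_nonneg.2 hle
  · have hmem : (⟨z, hz⟩ : {z : Θ → ℝ // 0 ≤ z}) ∈ closure (Set.range d) :=
      TopologicalSpace.denseRange_denseSeq _ _
    refine closure_mono ?_ (image_closure_subset_closure_image continuous_subtype_val
      (Set.mem_image_of_mem _ hmem))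
    rintro _ ⟨_, ⟨k, rfl⟩, rfl⟩
    exact ⟨(c k)⁻¹, Sum.inl k, inv_pos.2 (hc k), (inv_smul_smul₀ (hc k).ne' _).symm⟩

/-! ### Recovering the value function from the cones and the dense rays. -/

/-- The vertex `z` of a simplicial cone together with its displacements by `ε` along the axes. -/
def conePoint {Θ : Type u} [DecidableEq Θ] (z : Θ → ℝ) (ε : ℝ) (o : Option Θ) : Θ → ℝ :=
  o.elim z fun θ => z + ε • Pi.single θ 1

lemma conePoint_nonneg {Θ : Type u} [DecidableEq Θ] {z : Θ → ℝ} (hz : 0 ≤ z) {ε : ℝ} (hε : 0 ≤ ε)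
    (o : Option Θ) : 0 ≤ conePoint z ε o := by
  cases o with
  | none => exact hz
  | some θ => exact add_nonneg hz (smul_nonneg hε (Pi.single_nonneg.2 zero_le_one))

lemma sum_conePoint_pos [DecidableEq Θ] {z : Θ → ℝ} (hz : 0 ≤ z) {ε : ℝ} (hε : 0 < ε) (θ : Θ) :
    0 < (∑ o, conePoint z ε o) θ := by
  rw [Finset.sum_apply]
  refine Finset.sum_pos' (fun o _ => conePoint_nonneg hz hε.le o θ)
    ⟨some θ, Finset.mem_univ _, ?_⟩
  simpa [conePoint] using add_pos_of_nonneg_of_pos (hz θ) hε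

lemma expectedPayoff_conePoint_some [DecidableEq Θ] (z : Θ → ℝ) (ε : ℝ) (θ : Θ) (f : Θ → ℝ) :
    expectedPayoff (conePoint z ε (some θ)) f = expectedPayoff z f + ε * f θ := by
  have h : expectedPayoff (Pi.single θ 1) f = f θ := single_one_dotProduct θ f
  rw [conePoint, Option.elim_some, expectedPayoff_add, expectedPayoff_smul, h]

/-- The prior-weighted value is determined up to a linear function by additivity on a cone for
every undominated action, by its differences across these cones, and by its sum over a family
with dense rays. -/
lemma exists_value_eq_add_expectedPayoff [DecidableEq Θ] (D₀ D : DecisionProblem.{u, v} Θ)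
    {μ₀ μ : Θ → ℝ} (hμ₀ : IsFullSupportPrior μ₀) (hμ : IsFullSupportPrior μ)
    {z : D₀.Action → Θ → ℝ} {ε : ℝ} (hε : 0 < ε)
    (hz : ∀ a, Undominated D₀.utility a → 0 ≤ z a)
    (hopt : ∀ a, Undominated D₀.utility a → ∀ o, D₀.value (μ₀ * conePoint (z a) ε o) =
      expectedPayoff (μ₀ * conePoint (z a) ε o) (D₀.utility a))
    {a₀ : D₀.Action} (ha₀ : Undominated D₀.utility a₀)
    {q : ℕ ⊕ Unit → Θ → ℝ} (hq : ∀ i, 0 ≤ q i) (hqsum : HasSum q (∑ o, conePoint (z a₀) ε o))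
    (hdense : {x : Θ → ℝ | 0 ≤ x} ⊆ closure {x | ∃ c : ℝ, ∃ i, 0 < c ∧ x = c • q i})
    (hadd : ∀ a, Undominated D₀.utility a → D.value (μ * ∑ o, conePoint (z a) ε o) =
      ∑ o, D.value (μ * conePoint (z a) ε o))
    (hdiff : ∀ a, Undominated D₀.utility a → ∀ θ,
      D.value (μ * conePoint (z a) ε (some θ)) + D.value (μ * conePoint (z a₀) ε none) -
        (D.value (μ * conePoint (z a) ε none) + D.value (μ * conePoint (z a₀) ε (some θ))) =
      D₀.value (μ₀ * conePoint (z a) ε (some θ)) + D₀.value (μ₀ * conePoint (z a₀) ε none) -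
        (D₀.value (μ₀ * conePoint (z a) ε none) + D₀.value (μ₀ * conePoint (z a₀) ε (some θ))))
    (htot : ∑' i, D.value (μ * q i) - D.value (μ * ∑ o, conePoint (z a₀) ε o) =
      ∑' i, D₀.value (μ₀ * q i) - D₀.value (μ₀ * ∑ o, conePoint (z a₀) ε o)) :
    ∃ ℓ, ∀ x, 0 ≤ x → D.value (μ * x) = D₀.value (μ₀ * x) + expectedPayoff x ℓ := by
  have := hμ.nonempty
  have hμ0 : 0 ≤ μ := hμ.1.1
  have hμ₀0 : 0 ≤ μ₀ := hμ₀.1.1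
  have hcommon : ∀ a, ∃ b, Undominated D₀.utility a → ∀ o,
      D.value (μ * conePoint (z a) ε o) =
        expectedPayoff (conePoint (z a) ε o) (μ * D.utility b) := fun a => by
    by_cases ha : Undominated D₀.utility a
    · have h := hadd a ha
      rw [Finset.mul_sum, D.value_sum_eq_iff fun o =>
        mul_nonneg hμ0 (conePoint_nonneg (hz a ha) hε.le o)] at h
      obtain ⟨b, hb⟩ := h
      exact ⟨b, fun _ o => by rw [hb, expectedPayoff_mul]⟩
    · exact ⟨D.nonempty_action.some, fun h => absurd h ha⟩
  choose b hb using hcommon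
  simp only [expectedPayoff_mul] at hopt
  -- Each double difference is `ε` times a difference of slopes; the constants at the cone vertices
  -- cancel.
  have hslope : ∀ a, Undominated D₀.utility a → ∀ θ,
      (μ * D.utility (b a)) θ - (μ * D.utility (b a₀)) θ =
        (μ₀ * D₀.utility a) θ - (μ₀ * D₀.utility a₀) θ := fun a ha θ => by
    have h := hdiff a ha θ
    rw [hb a ha, hb a ha, hb a₀ ha₀, hb a₀ ha₀, hopt a ha, hopt a ha, hopt a₀ ha₀,
      hopt a₀ ha₀] at h
    simp only [expectedPayoff_conePoint_some] at h
    simp only [conePoint, Option.elim_none] at h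
    exact mul_left_cancel₀ hε.ne' (by linarith)
  set ℓ : Θ → ℝ := μ * D.utility (b a₀) - μ₀ * D₀.utility a₀ with hℓ
  have hpay : ∀ a, Undominated D₀.utility a → ∀ x : Θ → ℝ,
      expectedPayoff x (μ * D.utility (b a)) =
        expectedPayoff x (μ₀ * D₀.utility a) + expectedPayoff x ℓ := fun a ha x => by
    have : μ * D.utility (b a) = μ₀ * D₀.utility a + ℓ := funext fun θ => by
      have := hslope a ha θ
      simp only [hℓ, Pi.add_apply, Pi.sub_apply]
      linarith
    rw [this]
    exact dotProduct_add _ _ _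
  -- `D` can imitate the optimal undominated action `a` of `D₀` by `b a`, which pays the same up to
  -- `ℓ`.
  have hge : ∀ x, 0 ≤ x → D₀.value (μ₀ * x) + expectedPayoff x ℓ ≤ D.value (μ * x) :=
    fun x hx => by
      obtain ⟨a, ha, hval⟩ := D₀.exists_undominated_value_eq (mul_nonneg hμ₀0 hx)
      rw [hval, expectedPayoff_mul, ← hpay a ha, ← expectedPayoff_mul]
      exact D.expectedPayoff_le_value _ _
  have hsum_eq : D.value (μ * ∑ o, conePoint (z a₀) ε o) =
      D₀.value (μ₀ * ∑ o, conePoint (z a₀) ε o) +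
        expectedPayoff (∑ o, conePoint (z a₀) ε o) ℓ := by
    have h₀ : D₀.value (μ₀ * ∑ o, conePoint (z a₀) ε o) =
        ∑ o, D₀.value (μ₀ * conePoint (z a₀) ε o) := by
      rw [Finset.mul_sum, D₀.value_sum_eq_iff fun o =>
        mul_nonneg hμ₀0 (conePoint_nonneg (hz a₀ ha₀) hε.le o)]
      exact ⟨a₀, fun o => by rw [hopt a₀ ha₀, expectedPayoff_mul]⟩
    rw [hadd a₀ ha₀, h₀, expectedPayoff_finset_sum, ← Finset.sum_add_distrib]
    exact Finset.sum_congr rfl fun o _ => by rw [hb a₀ ha₀, hopt a₀ ha₀, hpay a₀ ha₀]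
  -- The gaps are nonnegative by `hge` and their total is zero, so each of them vanishes.
  have hgap : HasSum
      (fun i => D.value (μ * q i) - (D₀.value (μ₀ * q i) + expectedPayoff (q i) ℓ)) 0 := by
    have hlin : HasSum (fun i => expectedPayoff (q i) ℓ)
        (expectedPayoff (∑ o, conePoint (z a₀) ε o) ℓ) :=
      hasSum_sum fun θ _ => (Pi.hasSum.1 hqsum θ).mul_right (ℓ θ)
    have h := (D.summable_value μ hqsum.summable).hasSum.sub
      ((D₀.summable_value μ₀ hqsum.summable).hasSum.add hlin)
    have h0 : ∑' i, D.value (μ * q i) - (∑' i, D₀.value (μ₀ * q i) +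
        expectedPayoff (∑ o, conePoint (z a₀) ε o) ℓ) = 0 := by
      linarith
    rwa [h0] at h
  have hzero := (hasSum_zero_iff_of_nonneg fun i => sub_nonneg.2 (hge _ (hq i))).1 hgap
  have hclosed : IsClosed
      {x : Θ → ℝ | D.value (μ * x) = D₀.value (μ₀ * x) + expectedPayoff x ℓ} :=
    isClosed_eq (D.continuous_value.comp (by fun_prop))
      ((D₀.continuous_value.comp (by fun_prop)).add (continuous_expectedPayoff ℓ))
  refine ⟨ℓ, fun x hx => closure_minimal ?_ hclosed (hdense hx)⟩
  rintro _ ⟨c, i, hc, rfl⟩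
  have hi := sub_eq_zero.1 (congrFun hzero i)
  rw [Set.mem_ofPred_eq, D.value_mul_smul μ hc.le, D₀.value_mul_smul μ₀ hc.le,
    expectedPayoff_smul, hi, mul_add]

end ValueOfInformation

end

/-! ### Assembling the collection. -/

theorem mainTheorem4 {Θ : Type u} [Fintype Θ]
    (D₀ : ValueOfInformation.DecisionProblem.{u, v} Θ) (μ₀ : Θ → ℝ)
    (hμ₀ : ValueOfInformation.IsFullSupportPrior μ₀) :
    ∃ C : ValueOfInformation.Collection.{u, w} Θ,
      C.Identifies.{u, v, w} (fun π => D₀.infoValue μ₀ π) := by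
  classical
  open ValueOfInformation in
  have := hμ₀.nonempty
  have := D₀.finite_undominated.to_subtype
  obtain ⟨z, ε, hε, hz⟩ := D₀.exists_cone_of_undominated hμ₀
  obtain ⟨a₀, ha₀, -⟩ := D₀.exists_undominated_value_eq hμ₀.1.1
  have hnn : ∀ a, Undominated D₀.utility a → ∀ o, 0 ≤ conePoint (z a) ε o :=
    fun a ha => conePoint_nonneg (hz a ha).1 hε.le
  have hopt : ∀ a, Undominated D₀.utility a → ∀ o, D₀.value (μ₀ * conePoint (z a) ε o) =
      expectedPayoff (μ₀ * conePoint (z a) ε o) (D₀.utility a)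
    | a, ha, none => (hz a ha).2.1
    | a, ha, some θ => (hz a ha).2.2 θ
  obtain ⟨q, hq, hqsum, hdense⟩ := exists_hasSum_dense_rays (sum_conePoint_pos (hz a₀ ha₀).1 hε)
  have hunit : ∀ x : Θ → ℝ, HasSum (fun _ : Unit => x) x := fun x => by simp [hasSum_unique]
  -- Revealing the points of a cone against pooling them.
  have h₁ := fun a : {a | Undominated D₀.utility a} =>
    exists_experiment_pair.{u, v, w} (r := fun _ : Unit => ∑ o, conePoint (z a) ε o)
      (hnn a a.2) (fun _ => Finset.sum_nonneg fun o _ => hnn a a.2 o) (hasSum_fintype _)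
      (hunit _)
  -- Exchanging the displacement along `p.2` between the cones of `p.1` and `a₀` preserves the
  -- total.
  have h₂ := fun p : {a | Undominated D₀.utility a} × Θ =>
    exists_experiment_pair.{u, v, w}
      (q := ![conePoint (z p.1) ε (some p.2), conePoint (z a₀) ε none])
      (r := ![conePoint (z p.1) ε none, conePoint (z a₀) ε (some p.2)])
      (y := conePoint (z p.1) ε (some p.2) + conePoint (z a₀) ε none)
      (Fin.forall_fin_two.2 ⟨hnn p.1 p.1.2 (some p.2), hnn a₀ ha₀ none⟩)
      (Fin.forall_fin_two.2 ⟨hnn p.1 p.1.2 none, hnn a₀ ha₀ (some p.2)⟩)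
      (by simpa using hasSum_fintype
            ![conePoint (z p.1) ε (some p.2), conePoint (z a₀) ε none])
      (by have h := hasSum_fintype ![conePoint (z p.1) ε none, conePoint (z a₀) ε (some p.2)]
          rwa [Fin.sum_univ_two, Matrix.cons_val_zero, Matrix.cons_val_one,
            Matrix.cons_val_fin_one, show conePoint (z p.1) ε none + conePoint (z a₀) ε (some p.2) =
              conePoint (z p.1) ε (some p.2) + conePoint (z a₀) ε none by
              simp only [conePoint, Option.elim_none, Option.elim_some]; abel] at h)
  -- The family with dense rays against its pooled total, whose value is already known from the cone
  -- of `a₀`.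
  obtain ⟨π₃, π₃', c₃, hc₃, h₃⟩ := exists_experiment_pair.{u, v, w}
    (r := fun _ : Unit => ∑ o, conePoint (z a₀) ε o) hq
    (fun _ => Finset.sum_nonneg fun o _ => hnn a₀ ha₀ o) hqsum (hunit _)
  choose π₁ π₁' c₁ hc₁ h₁ using h₁
  choose π₂ π₂' c₂ hc₂ h₂ using h₂
  let W : Experiment.{u, w} Θ → ℝ := fun π => D₀.infoValue μ₀ π
  let π := Sum.elim π₁ (Sum.elim π₂ fun _ : Unit => π₃)
  let π' := Sum.elim π₁' (Sum.elim π₂' fun _ : Unit => π₃')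
  obtain ⟨C, hC⟩ := exists_collection.{u, v, w} π π' fun j => W (π j) - W (π' j)
  refine ⟨C, fun μ hμ => ?_, fun D μ hμ hsat => ?_⟩
  · obtain ⟨D, hD⟩ := exists_decisionProblem_value_eq D₀ hμ₀ hμ
    have hW : ∀ π : Experiment.{u, w} Θ, D.infoValue μ π = D₀.infoValue μ₀ π :=
      infoValue_eq_of_value_eq_add D D₀ hμ hμ₀ 0 fun x _ => by simp [hD, expectedPayoff]
    exact ⟨D, (hC D μ).2 fun j => by simp only [hW, W], hW⟩
  · have hj := (hC D μ).1 hsat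
    simp only [Sum.forall, π, π', Sum.elim_inl, Sum.elim_inr, W] at hj
    obtain ⟨hj₁, hj₂, hj₃⟩ := hj
    simp only [h₁ _ D μ hμ, h₁ _ D₀ μ₀ hμ₀, mul_right_inj' (hc₁ _).ne', tsum_fintype,
      Finset.univ_unique, Finset.sum_singleton] at hj₁
    simp only [h₂ _ D μ hμ, h₂ _ D₀ μ₀ hμ₀, mul_right_inj' (hc₂ _).ne', tsum_fintype,
      Fin.sum_univ_two, Matrix.cons_val_zero, Matrix.cons_val_one] at hj₂
    have hj₃ := hj₃ ()
    simp only [h₃ D μ hμ, h₃ D₀ μ₀ hμ₀, mul_right_inj' hc₃.ne', tsum_fintype,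
      Finset.univ_unique, Finset.sum_singleton] at hj₃
    have hadd : ∀ a, Undominated D₀.utility a → D.value (μ * ∑ o, conePoint (z a) ε o) =
        ∑ o, D.value (μ * conePoint (z a) ε o) := fun a ha => by
      have h₀ : D₀.value (μ₀ * ∑ o, conePoint (z a) ε o) =
          ∑ o, D₀.value (μ₀ * conePoint (z a) ε o) := by
        rw [Finset.mul_sum, D₀.value_sum_eq_iff fun o => mul_nonneg hμ₀.1.1 (hnn a ha o)]
        exact ⟨a, hopt a ha⟩
      have h := hj₁ ⟨a, ha⟩
      linarith
    obtain ⟨ℓ, hℓ⟩ := exists_value_eq_add_expectedPayoff D₀ D hμ₀ hμ hε (fun a ha => (hz a ha).1)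
      hopt ha₀ hq hqsum hdense hadd (fun a ha θ => hj₂ (⟨a, ha⟩, θ)) hj₃
    exact infoValue_eq_of_value_eq_add D D₀ hμ hμ₀ ℓ hℓ
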